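/- \textbf{Theorem.} Let $\mathcal V$ be a cocomplete Heyting semilattice, that is, a thin category (a preordered class, with $a\le b$ meaning that there is a morphism $a\to b$) which has finite meets, is cartesian closed (each $a\wedge -$ has a right adjoint $a\Rightarrow -$), and has all small joins; regard $\mathcal V$ as a monoidal category by means of $\wedge$ and the top element. Let $\mathcal V\text{-}\mathsf{Cat}$ be the category of small $\mathcal V$-categories and $\mathcal V$-functors, and let $F\colon\mathcal C\to\mathcal D$ be a $\mathcal V$-functor between small $\mathcal V$-categories. Suppose that $F$ is surjective on objects and that for all objects $y_0,y_1,y_2$ of $\mathcal D$ $$\bigvee_{\substack{x_0,x_1,x_2\in\mathcal C\\ Fx_0=y_0,\;Fx_1=y_1,\;Fx_2=y_2}}\mathcal C(x_1,x_2)\wedge\mathcal C(x_0,x_1)\;\cong\;\mathcal D(y_1,y_2)\wedge\mathcal D(y_0,y_1).$$ Then $F$ is effective for descent in $\mathcal V\text{-}\mathsf{Cat}$: the comparison functor $\mathcal V\text{-}\mathsf{Cat}/\mathcal D\to\mathrm{Desc}(F)$ is an equivalence of categories. Here $\mathrm{Desc}(F)$ is the category of descent data for $F$, i.e. of $\mathcal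 V$-functors $W\to\mathcal C$ equipped with a unital and associative action $W\times_{\mathcal D}\mathcal C\to W$ over $\mathcal C$ (the Eilenberg--Moore algebras of the monad on $\mathcal V\text{-}\mathsf{Cat}/\mathcal C$ induced by the adjunction $F_!\dashv F^*$ between composition with $F$ and pullback along $F$), and the comparison functor sends an object over $\mathcal D$ to its pullback along $F$ with the canonical descent datum. -/

import Mathlib

open CategoryTheory Limits MonoidalCategory

universe w v u

/-- A small `V`-category: a type of objects together with an enrichment in `V`. -/
structure VCat (V : Type v) [Category.{w} V] [MonoidalCategory V] where
  /-- The objects. -/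
  carrier : Type u
  /-- The hom-objects, units and composition. -/
  [str : EnrichedCategory V carrier]

namespace VCat

section

variable {V : Type v} [Category.{w} V] [MonoidalCategory V]

instance : CoeSort (VCat.{w, v, u} V) (Type u) := ⟨VCat.carrier⟩

instance (C : VCat.{w, v, u} V) : EnrichedCategory V C := C.str

/-- The category `V-Cat` of small `V`-categories and `V`-functors. -/
instance : Category (VCat.{w, v, u} V) where
  Hom C D := EnrichedFunctor V C D
  id C := EnrichedFunctor.id V C
  comp F G := EnrichedFunctor.comp V F G
  id_comp _ := EnrichedFunctor.ext V (fun _ => rfl)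
    (fun _ _ => (Category.comp_id _).trans (Category.id_comp _))
  comp_id _ := EnrichedFunctor.ext V (fun _ => rfl)
    (fun _ _ => (Category.comp_id _).trans (Category.comp_id _))
  assoc _ _ _ := EnrichedFunctor.ext V (fun _ => rfl)
    (fun _ _ => (Category.comp_id _).trans (Category.assoc _ _ _))

/-- The function on objects underlying a morphism of `V-Cat`. -/
def onObj {C D : VCat.{w, v, u} V} (F : C ⟶ D) : C → D :=
  EnrichedFunctor.obj (V := V) (C := C) (D := D) F

/-- The fibre `F^* y` of a `V`-functor over an object `y` of the codomain. -/
def Fibre {C D : VCat.{w, v, u} V} (F : C ⟶ D) (y : D) : Type u :=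
  {x : C // onObj F x = y}

end

section Thin

variable {V : Type v} [Category.{w} V] [CartesianMonoidalCategory V] [Quiver.IsThin V]

open CartesianMonoidalCategory

lemma hom_ext_of_thin {C D : VCat.{w, v, u} V} {F G : C ⟶ D}
    (h : ∀ x, onObj F x = onObj G x) : F = G :=
  EnrichedFunctor.ext V h (fun _ _ => Subsingleton.elim _ _)

/-- The pullback of `V`-categories for thin `V`: objects are pairs with the same image, and
hom-objects are meets. -/
def pullbackObj {A B D : VCat.{w, v, u} V} (F : A ⟶ D) (G : B ⟶ D) : VCat.{w, v, u} V where
  carrier := {p : A × B // onObj F p.1 = onObj G p.2}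
  str :=
    { Hom := fun p q => (p.1.1 ⟶[V] q.1.1) ⊗ (p.1.2 ⟶[V] q.1.2)
      id := fun p => lift (eId V p.1.1) (eId V p.1.2)
      comp := fun p q r => lift
        ((fst _ _ ⊗ₘ fst _ _) ≫ eComp V p.1.1 q.1.1 r.1.1)
        ((snd _ _ ⊗ₘ snd _ _) ≫ eComp V p.1.2 q.1.2 r.1.2)
      id_comp := fun _ _ => Subsingleton.elim _ _
      comp_id := fun _ _ => Subsingleton.elim _ _
      assoc := fun _ _ _ _ => Subsingleton.elim _ _ }

/-- The first projection. -/
def pullbackFst {A B D : VCat.{w, v, u} V} (F : A ⟶ D) (G : B ⟶ D) :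
    pullbackObj F G ⟶ A :=
  { obj := fun p => p.1.1
    map := fun _ _ => fst _ _
    map_id := fun _ => Subsingleton.elim _ _
    map_comp := fun _ _ _ => Subsingleton.elim _ _ : EnrichedFunctor V (pullbackObj F G) A }

/-- The second projection. -/
def pullbackSnd {A B D : VCat.{w, v, u} V} (F : A ⟶ D) (G : B ⟶ D) :
    pullbackObj F G ⟶ B :=
  { obj := fun p => p.1.2
    map := fun _ _ => snd _ _
    map_id := fun _ => Subsingleton.elim _ _
    map_comp := fun _ _ _ => Subsingleton.elim _ _ : EnrichedFunctor V (pullbackObj F G) B }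

/-- The map into the pullback induced by a commutative square. -/
def pullbackLift {A B D E : VCat.{w, v, u} V} (F : A ⟶ D) (G : B ⟶ D) (P : E ⟶ A) (Q : E ⟶ B)
    (h : P ≫ F = Q ≫ G) : E ⟶ pullbackObj F G :=
  { obj := fun e => ⟨(onObj P e, onObj Q e), congrArg (fun K : E ⟶ D => onObj K e) h⟩
    map := fun x y => lift (EnrichedFunctor.map (V := V) (C := E) (D := A) P x y)
      (EnrichedFunctor.map (V := V) (C := E) (D := B) Q x y)
    map_id := fun _ => Subsingleton.elim _ _
    map_comp := fun _ _ _ => Subsingleton.elim _ _ : EnrichedFunctor V E (pullbackObj F G) }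

lemma isPullback {A B D : VCat.{w, v, u} V} (F : A ⟶ D) (G : B ⟶ D) :
    IsPullback (pullbackFst F G) (pullbackSnd F G) F G :=
  { w := hom_ext_of_thin fun p => p.2
    isLimit' := ⟨PullbackCone.IsLimit.mk _
      (fun s => pullbackLift F G s.fst s.snd s.condition)
      (fun _ => hom_ext_of_thin fun _ => rfl)
      (fun _ => hom_ext_of_thin fun _ => rfl)
      (fun s _ h₁ h₂ => hom_ext_of_thin fun e => Subtype.ext (Prod.ext
        (congrArg (fun K : s.pt ⟶ A => onObj K e) h₁)
        (congrArg (fun K : s.pt ⟶ B => onObj K e) h₂)))⟩ }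

instance : HasPullbacks (VCat.{w, v, u} V) :=
  have : ∀ {A B D : VCat.{w, v, u} V} {F : A ⟶ D} {G : B ⟶ D}, HasLimit (cospan F G) :=
    fun {_ _ _ F G} => (isPullback F G).hasPullback
  hasPullbacks_of_hasLimit_cospan _

end Thin

end VCat

/-- The category of descent data for `p : X ⟶ Y`: objects `W ⟶ X` over `X` with an action
`W ×_Y X ⟶ W` over `X` that is unital and associative, that is, the Eilenberg-Moore algebras of
the monad induced by the adjunction `p_! ⊣ p^*` between the slices over `X` and `Y`. -/
noncomputable abbrev Desc {K : Type*} [Category K] [HasPullbacks K] {X Y : K} (p : X ⟶ Y) :=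
  (Over.mapPullbackAdj p).toMonad.Algebra

/-- The comparison functor from the slice over `Y` to the descent data for `p : X ⟶ Y`; it sends
an object over `Y` to its pullback along `p` with the canonical descent datum. -/
noncomputable abbrev descComparison {K : Type*} [Category K] [HasPullbacks K] {X Y : K}
    (p : X ⟶ Y) : Over Y ⥤ Desc p :=
  Monad.comparison (Over.mapPullbackAdj p)

/-- `p` is effective for descent if the comparison functor is an equivalence (equivalently, the
pullback functor `p^*` is monadic). -/
def IsEffectiveForDescent {K : Type*} [Category K] [HasPullbacks K] {X Y : K} (p : X ⟶ Y) : Prop :=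
  (descComparison p).IsEquivalence

/-! Since `V` is thin, a `V`-functor is a map on objects that satisfies hom inequalities, so descent
splits into a statement about sets and one about homs. On objects, a descent datum `W` lets `w` be
moved to any `x` in its fibre of `F` (`Desc.act`). The unit and associativity laws say that each
orbit meets every point of that fibre exactly once, so a section of `F` picks one representative per
orbit and `W` is, on objects, the pullback of its orbits.

For homs, an orbit hom is the join of the homs between members of the two orbits. Acting by x ≤ x'
moves any such hom to the members over x and x' (`Desc.nonempty_orbitHom_act`), so pulling the
orbits back recovers the homs of `W`. The join hypothesis enters twice: orbit homs compose because a
composable pair in `D` lifts, jointwise, to a composable pair in `C`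
(`Desc.nonempty_orbitHom_comp`), and maps of descent data descend because single homs lift likewise.
Faithfulness needs only surjectivity on objects. -/

namespace VCat

/-! ### Inequalities in a thin `V`, tested on generalized elements -/

section Functor

variable {V : Type v} [Category.{w} V] [MonoidalCategory V]

lemma onObj_comp {A B C : VCat.{w, v, u} V} (F : A ⟶ B) (G : B ⟶ C) (a : A) :
    onObj (F ≫ G) a = onObj G (onObj F a) := rfl

lemma nonempty_map {A B : VCat.{w, v, u} V} (F : A ⟶ B) (a a' : A) :
    Nonempty ((a ⟶[V] a') ⟶ (onObj F a ⟶[V] onObj F a')) :=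
  ⟨EnrichedFunctor.map (V := V) (C := A) (D := B) F a a'⟩

end Functor

lemma nonempty_trans {V : Type v} [Category.{w} V] {X Y Z : V} : Nonempty (X ⟶ Y) → Nonempty (Y ⟶ Z) → Nonempty (X ⟶ Z) :=
  fun ⟨f⟩ ⟨g⟩ => ⟨f ≫ g⟩

variable {V : Type v} [Category.{w} V] [CartesianMonoidalCategory V]

open CartesianMonoidalCategory

lemma nonempty_lift {X Y Z : V} :
    Nonempty (X ⟶ Y) → Nonempty (X ⟶ Z) → Nonempty (X ⟶ Y ⊗ Z) :=
  fun ⟨f⟩ ⟨g⟩ => ⟨lift f g⟩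

lemma nonempty_comp {A : VCat.{w, v, u} V} {X : V} {a b c : A} :
    Nonempty (X ⟶ (a ⟶[V] b)) → Nonempty (X ⟶ (b ⟶[V] c)) → Nonempty (X ⟶ (a ⟶[V] c)) :=
  fun ⟨f⟩ ⟨g⟩ => ⟨lift f g ≫ eComp V a b c⟩

/-- Case analysis on a join: binary meets distribute over joins. -/
lemma nonempty_of_sigma [MonoidalClosed V] {ι : Type u} {f : ι → V} [HasCoproduct f] {X Y : V}
    (h : Nonempty (X ⟶ ∐ f)) (k : ∀ i, Nonempty (X ⊗ f i ⟶ Y)) : Nonempty (X ⟶ Y) := by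
  obtain ⟨h⟩ := h
  exact ⟨lift (𝟙 X) h ≫
    MonoidalClosed.uncurry (Sigma.desc fun i => MonoidalClosed.curry (k i).some)⟩

variable [Quiver.IsThin V]

/-- For thin `V`, a `V`-functor is a function on objects satisfying an inequality on homs. -/
noncomputable def homMk {A B : VCat.{w, v, u} V} (f : A → B)
    (h : ∀ a a' : A, Nonempty ((a ⟶[V] a') ⟶ (f a ⟶[V] f a'))) : A ⟶ B :=
  { obj := f
    map := fun a a' => (h a a').some
    map_id := fun _ => Subsingleton.elim _ _
    map_comp := fun _ _ _ => Subsingleton.elim _ _ : EnrichedFunctor V A B }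

lemma isIso_of_bijective {A B : VCat.{w, v, u} V} (F : A ⟶ B)
    (hF : Function.Bijective (onObj F))
    (h : ∀ a a' : A, Nonempty ((onObj F a ⟶[V] onObj F a') ⟶ (a ⟶[V] a'))) : IsIso F := by
  let e := Equiv.ofBijective _ hF
  have he (b : B) : onObj F (e.symm b) = b := e.apply_symm_apply b
  refine ⟨homMk e.symm fun b b' => ?_, hom_ext_of_thin fun a => e.symm_apply_apply a,
    hom_ext_of_thin he⟩
  have := h (e.symm b) (e.symm b')
  rwa [he, he] at this

/-! ### Objects and homs of the chosen pullback, as pairs -/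

section Pullback

variable {A B D : VCat.{w, v, u} V} (F : A ⟶ D) (G : B ⟶ D)

lemma pullback_w (z : ↑(pullback F G)) :
    onObj F (onObj (pullback.fst F G) z) = onObj G (onObj (pullback.snd F G) z) :=
  congrArg (fun K : pullback F G ⟶ D => onObj K z) pullback.condition

variable {F G}

/-- The object of the pullback determined by a pair of objects with the same image. -/
noncomputable def pullbackPt (a : A) (b : B) (h : onObj F a = onObj G b) : ↑(pullback F G) :=
  onObj (isPullback F G).isoPullback.hom ⟨(a, b), h⟩

@[simp] lemma fst_pullbackPt (a : A) (b : B) (h : onObj F a = onObj G b) :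
    onObj (pullback.fst F G) (pullbackPt a b h) = a :=
  congrArg (fun K : pullbackObj F G ⟶ A => onObj K ⟨(a, b), h⟩)
    (isPullback F G).isoPullback_hom_fst

@[simp] lemma snd_pullbackPt (a : A) (b : B) (h : onObj F a = onObj G b) :
    onObj (pullback.snd F G) (pullbackPt a b h) = b :=
  congrArg (fun K : pullbackObj F G ⟶ B => onObj K ⟨(a, b), h⟩)
    (isPullback F G).isoPullback_hom_snd

lemma pullbackPt_congr {a a' : A} {b b' : B} (ha : a = a') (hb : b = b')
    (h : onObj F a = onObj G b) (h' : onObj F a' = onObj G b') :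
    pullbackPt a b h = pullbackPt a' b' h' := by
  subst ha hb
  rfl

lemma pullback_ext {z z' : ↑(pullback F G)}
    (h₁ : onObj (pullback.fst F G) z = onObj (pullback.fst F G) z')
    (h₂ : onObj (pullback.snd F G) z = onObj (pullback.snd F G) z') : z = z' := by
  have key (z : ↑(pullback F G)) : pullbackPt _ _ (pullback_w F G z) = z := by
    have e : onObj (isPullback F G).isoPullback.inv z =
        ⟨(onObj (pullback.fst F G) z, onObj (pullback.snd F G) z), pullback_w F G z⟩ := by
      refine Subtype.ext (Prod.ext ?_ ?_)
      · exact congrArg (fun K : pullback F G ⟶ A => onObj K z)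
          (isPullback F G).isoPullback_inv_fst
      · exact congrArg (fun K : pullback F G ⟶ B => onObj K z)
          (isPullback F G).isoPullback_inv_snd
    rw [pullbackPt, ← e]
    exact congrArg (fun K : pullback F G ⟶ pullback F G => onObj K z)
      (isPullback F G).isoPullback.inv_hom_id
  rw [← key z, ← key z']
  exact pullbackPt_congr h₁ h₂ _ _

lemma pullbackPt_fst_snd (z : ↑(pullback F G)) :
    pullbackPt (onObj (pullback.fst F G) z) (onObj (pullback.snd F G) z) (pullback_w F G z) = z :=
  pullback_ext (fst_pullbackPt _ _ _) (snd_pullbackPt _ _ _)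

lemma nonempty_pullback_hom (z z' : ↑(pullback F G)) {X : V}
    (h₁ : Nonempty (X ⟶ (onObj (pullback.fst F G) z ⟶[V] onObj (pullback.fst F G) z')))
    (h₂ : Nonempty (X ⟶ (onObj (pullback.snd F G) z ⟶[V] onObj (pullback.snd F G) z'))) :
    Nonempty (X ⟶ (z ⟶[V] z')) := by
  rw [← pullbackPt_fst_snd z, ← pullbackPt_fst_snd z']
  exact nonempty_trans (nonempty_lift h₁ h₂)
    (nonempty_map (isPullback F G).isoPullback.hom
      ⟨(_, _), pullback_w F G z⟩ ⟨(_, _), pullback_w F G z'⟩)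

lemma nonempty_pullbackPt_hom {X : V} {a a' : A} {b b' : B} (h : onObj F a = onObj G b)
    (h' : onObj F a' = onObj G b') (h₁ : Nonempty (X ⟶ (a ⟶[V] a')))
    (h₂ : Nonempty (X ⟶ (b ⟶[V] b'))) :
    Nonempty (X ⟶ (pullbackPt a b h ⟶[V] pullbackPt a' b' h')) :=
  nonempty_pullback_hom _ _ (by simpa using h₁) (by simpa using h₂)

lemma onObj_lift {E : VCat.{w, v, u} V} (P : E ⟶ A) (Q : E ⟶ B) (w : P ≫ F = Q ≫ G) (e : E)
    (h : onObj F (onObj P e) = onObj G (onObj Q e)) :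
    onObj (pullback.lift P Q w) e = pullbackPt (onObj P e) (onObj Q e) h := by
  refine pullback_ext ?_ ?_
  · rw [← onObj_comp, pullback.lift_fst, fst_pullbackPt]
  · rw [← onObj_comp, pullback.lift_snd, snd_pullbackPt]

lemma pullback_map_pullbackPt {X Y : Over D} (k : X ⟶ Y) (G : B ⟶ D) (a : X.left) (b : B)
    (a' : Y.left) (e : onObj k.left a = a')
    (h : onObj X.hom a = onObj G b) (h' : onObj Y.hom a' = onObj G b) :
    onObj ((Over.pullback G).map k).left (pullbackPt (F := X.hom) (G := G) a b h) =
      pullbackPt (F := Y.hom) (G := G) a' b h' := by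
  have h₁ : ((Over.pullback G).map k).left ≫ pullback.fst Y.hom G =
    pullback.fst X.hom G ≫ k.left := pullback.lift_fst _ _ _
  have h₂ : ((Over.pullback G).map k).left ≫ pullback.snd Y.hom G =
    pullback.snd X.hom G := pullback.lift_snd _ _ _
  refine pullback_ext ?_ ?_
  · refine (congrArg (fun K : pullback X.hom G ⟶ Y.left => onObj K (pullbackPt a b h)) h₁).trans ?_
    rw [fst_pullbackPt, onObj_comp, fst_pullbackPt, e]
  · refine (congrArg (fun K : pullback X.hom G ⟶ B => onObj K (pullbackPt a b h)) h₂).trans ?_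
    rw [snd_pullbackPt, snd_pullbackPt]

end Pullback

/-! ### Descent data as actions on objects -/

section Action

variable {V : Type v} [Category.{w} V] [CartesianMonoidalCategory V] [Quiver.IsThin V]
  {C D : VCat.{w, v, u} V} {F : C ⟶ D}

/-- The structure map of a descent datum, as a `V`-functor out of the pullback. -/
noncomputable def Desc.action (W : Desc F) : pullback (W.A.hom ≫ F) F ⟶ W.A.left := W.a.left

/-- The action of an object `x` of the base on an object `w` of a descent datum. -/
noncomputable def Desc.act (W : Desc F) (w : W.A.left) (x : C)
    (h : onObj F (onObj W.A.hom w) = onObj F x) : W.A.left :=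
  onObj (Desc.action W) (pullbackPt (F := W.A.hom ≫ F) w x h)

lemma Desc.hom_act (W : Desc F) (w : W.A.left) (x : C)
    (h : onObj F (onObj W.A.hom w) = onObj F x) :
    onObj W.A.hom (Desc.act W w x h) = x :=
  (congrArg (fun K : pullback (W.A.hom ≫ F) F ⟶ C => onObj K (pullbackPt w x h))
    (Over.w W.a)).trans (snd_pullbackPt w x h)

lemma Desc.act_self (W : Desc F) (w : W.A.left) :
    Desc.act W w (onObj W.A.hom w) rfl = w := by
  have e : onObj (pullback.lift (f := W.A.hom ≫ F) (g := F) (𝟙 W.A.left) W.A.hom (by simp)) w =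
      pullbackPt (F := W.A.hom ≫ F) (G := F) w (onObj W.A.hom w) rfl := 
    onObj_lift (F := W.A.hom ≫ F) (G := F) (𝟙 W.A.left) W.A.hom (by simp) w rfl
  -- The adjunction unit sends `w` to the pair of `w` and its image in `C`.
  have h : (Over.mapPullbackAdj F).unit.app W.A ≫ W.a = 𝟙 _ := W.unit
  rw [Over.mapPullbackAdj_unit_app] at h
  rw [Desc.act, ← e]
  exact congrArg (fun K : W.A ⟶ W.A => onObj K.left w) h

lemma Desc.act_act (W : Desc F) (w : W.A.left) (x x' : C)
    (h : onObj F (onObj W.A.hom w) = onObj F x) (h' : onObj F x = onObj F x') :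
    Desc.act W (Desc.act W w x h) x' ((congrArg (onObj F) (Desc.hom_act W w x h)).trans h') =
      Desc.act W w x' (h.trans h') := by
  let z : ↑(pullback (W.A.hom ≫ F) F) := pullbackPt (F := W.A.hom ≫ F) w x h
  have hz : onObj ((Over.mapPullbackAdj F).counit.app ((Over.map F).obj W.A)).left z = w := by
    rw [Over.mapPullbackAdj_counit_app]
    exact fst_pullbackPt (F := W.A.hom ≫ F) w x h
  have hz' := (congrArg (onObj F) (snd_pullbackPt (F := W.A.hom ≫ F) w x h)).trans h'
  have h₁ := pullback_map_pullbackPt ((Over.map F).map W.a) F z x' _ rfl hz'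
    ((congrArg (onObj F) (Desc.hom_act W w x h)).trans h')
  have h₂ := pullback_map_pullbackPt
    ((Over.mapPullbackAdj F).counit.app ((Over.map F).obj W.A)) F z x' w hz hz' (h.trans h')
  -- The monad multiplication is the pulled-back counit, which forgets `x`; evaluate associativity
  -- at ((w, x), x').
  have hc : (Over.pullback F).map ((Over.mapPullbackAdj F).counit.app ((Over.map F).obj W.A)) ≫
    W.a = (Over.pullback F).map ((Over.map F).map W.a) ≫ W.a := W.assoc
  refine (congrArg (onObj (Desc.action W)) h₁).symm.trans
    (Eq.trans ?_ (congrArg (onObj (Desc.action W)) h₂))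
  exact (congrArg (fun K => onObj K.left (pullbackPt z x' hz')) hc).symm

lemma Desc.nonempty_act (W : Desc F) {X : V} (w w' : W.A.left) (x x' : C)
    (h : onObj F (onObj W.A.hom w) = onObj F x) (h' : onObj F (onObj W.A.hom w') = onObj F x')
    (hw : Nonempty (X ⟶ (w ⟶[V] w'))) (hx : Nonempty (X ⟶ (x ⟶[V] x'))) :
    Nonempty (X ⟶ (Desc.act W w x h ⟶[V] Desc.act W w' x' h')) :=
  nonempty_trans (nonempty_pullbackPt_hom (F := W.A.hom ≫ F) h h' hw hx)
    (nonempty_map (Desc.action W) _ _)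

lemma Desc.act_congr (W : Desc F) {w w' : W.A.left} {x x' : C} (hw : w = w') (hx : x = x')
    (h : onObj F (onObj W.A.hom w) = onObj F x) :
    Desc.act W w x h = Desc.act W w' x' (hw ▸ hx ▸ h) := by
  subst hw hx
  rfl

lemma Desc.onObj_hom {W W' : Desc F} (f : W.A ⟶ W'.A) (w : W.A.left) :
    onObj W'.A.hom (onObj f.left w) = onObj W.A.hom w :=
  congrArg (fun K : W.A.left ⟶ C => onObj K w) (Over.w f)

lemma Desc.action_map {W W' : Desc F} (f : W.A ⟶ W'.A) (w : W.A.left) (x : C)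
    (h : onObj F (onObj W.A.hom w) = onObj F x) :
    onObj ((Over.mapPullbackAdj F).toMonad.map f ≫ W'.a).left
      (pullbackPt (F := W.A.hom ≫ F) (G := F) w x h) =
      Desc.act W' (onObj f.left w) x ((congrArg (onObj F) (Desc.onObj_hom f w)).trans h) :=
  congrArg (onObj (Desc.action W')) (pullback_map_pullbackPt ((Over.map F).map f) F w x _ rfl h
    ((congrArg (onObj F) (Desc.onObj_hom f w)).trans h))

lemma Desc.map_act {W W' : Desc F} (f : W ⟶ W') (w : W.A.left) (x : C)
    (h : onObj F (onObj W.A.hom w) = onObj F x) :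
    onObj f.f.left (Desc.act W w x h) = Desc.act W' (onObj f.f.left w) x
      ((congrArg (onObj F) (Desc.onObj_hom f.f w)).trans h) :=
  (congrArg (fun K : (Over.mapPullbackAdj F).toMonad.obj W.A ⟶ W'.A => onObj K.left
    (pullbackPt (F := W.A.hom ≫ F) (G := F) w x h)) f.h).symm.trans (Desc.action_map f.f w x h)

/-- A morphism over the base commuting with the actions is a morphism of descent data. -/
def Desc.homMk {W W' : Desc F} (f : W.A ⟶ W'.A)
    (hf : ∀ (w : W.A.left) (x : C) (h : onObj F (onObj W.A.hom w) = onObj F x),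
      onObj f.left (Desc.act W w x h) = Desc.act W' (onObj f.left w) x
        ((congrArg (onObj F) (Desc.onObj_hom f w)).trans h)) : W ⟶ W' where
  f := f
  h := by
    refine Over.OverMorphism.ext (hom_ext_of_thin fun (z : ↑(pullback (W.A.hom ≫ F) F)) => ?_)
    rw [← pullbackPt_fst_snd z]
    exact (Desc.action_map f _ _ (pullback_w _ _ z)).trans (hf _ _ _).symm

/-- The canonical descent datum only replaces the second coordinate. -/
lemma Desc.act_comparison (A : Over D) (a : A.left) (x x' : C)
    (h : onObj A.hom a = onObj F x) (h' : onObj A.hom a = onObj F x')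
    (h'' : onObj F (onObj ((descComparison F).obj A).A.hom
      (pullbackPt (F := A.hom) (G := F) a x h)) = onObj F x') :
    Desc.act ((descComparison F).obj A) (pullbackPt (F := A.hom) (G := F) a x h) x' h'' =
      pullbackPt (F := A.hom) (G := F) a x' h' := by
  refine pullback_map_pullbackPt ((Over.mapPullbackAdj F).counit.app A) F _ x' a ?_ h'' h'
  rw [Over.mapPullbackAdj_counit_app]
  exact fst_pullbackPt (F := A.hom) a x h

end Action

/-! ### Lifting composable pairs along `F` -/

section Cover

open CartesianMonoidalCategory

variable {V : Type v} [Category.{w} V] [CartesianMonoidalCategory V]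
  [MonoidalClosed V] [HasColimitsOfSize.{u, u} V] {C D : VCat.{w, v, u} V} {F : C ⟶ D}

/-- Every composable pair of homs of the codomain is covered by the composable pairs above it. -/
def CoversPairs (F : C ⟶ D) : Prop :=
  ∀ y₀ y₁ y₂ : D, Nonempty (((y₁ ⟶[V] y₂) ⊗ (y₀ ⟶[V] y₁) : V) ⟶
    ∐ fun x : VCat.Fibre F y₀ × VCat.Fibre F y₁ × VCat.Fibre F y₂ =>
      ((x.2.1.1 ⟶[V] x.2.2.1) ⊗ (x.1.1 ⟶[V] x.2.1.1) : V))

/-- Meets distribute over the covering join, so X ≤ Y may be checked on those Z ≤ X over which the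
pair lifts to `C`. -/
lemma CoversPairs.nonempty_of_pair (hF : CoversPairs F) {X Y : V} {y₀ y₁ y₂ : D}
    (h : Nonempty (X ⟶ (y₀ ⟶[V] y₁))) (h' : Nonempty (X ⟶ (y₁ ⟶[V] y₂)))
    (k : ∀ x₀ x₁ x₂ : C, onObj F x₀ = y₀ → onObj F x₁ = y₁ → onObj F x₂ = y₂ → ∀ {Z : V},
      Nonempty (Z ⟶ X) → Nonempty (Z ⟶ (x₀ ⟶[V] x₁)) → Nonempty (Z ⟶ (x₁ ⟶[V] x₂)) →
        Nonempty (Z ⟶ Y)) : Nonempty (X ⟶ Y) :=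
  nonempty_of_sigma (nonempty_trans (nonempty_lift h' h) (hF y₀ y₁ y₂)) fun x =>
    k _ _ _ x.1.2 x.2.1.2 x.2.2.2 ⟨fst _ _⟩ ⟨snd _ _ ≫ snd _ _⟩ ⟨snd _ _ ≫ fst _ _⟩

lemma CoversPairs.nonempty_of_hom (hF : CoversPairs F) {X Y : V} {y₀ y₁ : D}
    (h : Nonempty (X ⟶ (y₀ ⟶[V] y₁)))
    (k : ∀ x₀ x₁ : C, onObj F x₀ = y₀ → onObj F x₁ = y₁ → ∀ {Z : V},
      Nonempty (Z ⟶ X) → Nonempty (Z ⟶ (x₀ ⟶[V] x₁)) → Nonempty (Z ⟶ Y)) :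
    Nonempty (X ⟶ Y) :=
  -- A single hom is paired with the identity of `y₁`; the lift of the identity is discarded.
  hF.nonempty_of_pair h ⟨toUnit X ≫ eId V y₁⟩ fun x₀ x₁ _ h₀ h₁ _ _ hZ hZ' _ =>
    k x₀ x₁ h₀ h₁ hZ hZ'

end Cover

/-! ### Full faithfulness of the comparison -/

section FullyFaithful

variable {V : Type v} [Category.{w} V] [Quiver.IsThin V] [CartesianMonoidalCategory V]
  {C D : VCat.{w, v, u} V} {F : C ⟶ D}

lemma pullback_faithful (hsurj : Function.Surjective (onObj F)) : (Over.pullback F).Faithful where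
  map_injective {A B k k'} hk := by
    refine Over.OverMorphism.ext (hom_ext_of_thin fun a => ?_)
    obtain ⟨x, hx⟩ := hsurj (onObj A.hom a)
    have e (k : A ⟶ B) : onObj B.hom (onObj k.left a) = onObj F x :=
      (congrArg (fun K : A.left ⟶ D => onObj K a) (Over.w k)).trans hx.symm
    have h := (pullback_map_pullbackPt k F a x _ rfl hx.symm (e k)).symm.trans
      ((congrArg (fun K => onObj K.left (pullbackPt (F := A.hom) (G := F) a x hx.symm)) hk).trans
        (pullback_map_pullbackPt k' F a x _ rfl hx.symm (e k')))
    have h₂ := congrArg (onObj (pullback.fst B.hom F)) h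
    rwa [fst_pullbackPt, fst_pullbackPt] at h₂

lemma descComparison_full [MonoidalClosed V] [HasColimitsOfSize.{u, u} V]
    (hsurj : Function.Surjective (onObj F)) (hF : CoversPairs F) : (descComparison F).Full where
  map_surjective {A B} f := by
    choose s hs using hsurj
    let g : pullback A.hom F ⟶ pullback B.hom F := f.f.left
    -- The descended map is read off at the section point over `a`; equivariance (`key`) shows that
    -- any other point gives the same value.
    let z (a : A.left) : ↑(pullback A.hom F) := pullbackPt a (s (onObj A.hom a)) (hs _).symm
    let k (a : A.left) : B.left := onObj (pullback.fst B.hom F) (onObj g (z a))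
    have hg (z) : onObj (pullback.snd B.hom F) (onObj g z) = onObj (pullback.snd A.hom F) z :=
      Desc.onObj_hom f.f z
    have hk (a : A.left) : onObj B.hom (k a) = onObj A.hom a := by
      rw [pullback_w, hg, snd_pullbackPt, hs]
    have key (a : A.left) (x : C) (h : onObj A.hom a = onObj F x) :
        onObj g (pullbackPt a x h) = pullbackPt (k a) x ((hk a).trans h) := by
      have h₀ : onObj F (onObj ((descComparison F).obj A).A.hom (z a)) = onObj F x :=
        (congrArg (onObj F) (snd_pullbackPt _ _ _)).trans ((hs _).trans h)
      have h₁ := Desc.map_act f (z a) x h₀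
      rw [Desc.act_comparison A a _ x (hs _).symm h] at h₁
      refine h₁.trans ?_
      have h₂ : pullbackPt (k a) (s (onObj A.hom a)) ((hk a).trans (hs _).symm) = onObj g (z a) :=
        pullback_ext (fst_pullbackPt _ _ _) (by rw [snd_pullbackPt, hg, snd_pullbackPt])
      exact (Desc.act_congr _ h₂.symm rfl _).trans (Desc.act_comparison B (k a) _ x _ _ _)
    have hom_k (a a' : A.left) : Nonempty ((a ⟶[V] a') ⟶ (k a ⟶[V] k a')) := by
      refine hF.nonempty_of_hom (nonempty_map A.hom a a') fun x x' h h' Z hZ hZ' => ?_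
      have := nonempty_trans (nonempty_trans (nonempty_pullbackPt_hom h.symm h'.symm hZ hZ')
        (nonempty_map g _ _)) (nonempty_map (pullback.fst B.hom F) _ _)
      rwa [key, key, fst_pullbackPt, fst_pullbackPt] at this
    let K : A ⟶ B := Over.homMk (homMk k hom_k) (hom_ext_of_thin hk)
    refine ⟨K, Monad.Algebra.Hom.ext (Over.OverMorphism.ext (hom_ext_of_thin
      fun (z : ↑(pullback A.hom F)) => ?_))⟩
    rw [← pullbackPt_fst_snd z]
    exact (pullback_map_pullbackPt K F _ _ _ rfl _ _).trans (key _ _ _).symm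

end FullyFaithful

/-! ### Essential surjectivity: the category of orbits -/

section EssSurj

open CartesianMonoidalCategory

variable {V : Type v} [Category.{w} V] [Quiver.IsThin V] [CartesianMonoidalCategory V]
  {C D : VCat.{w, v, u} V} {F : C ⟶ D}

/-- The object of the codomain below an object of a descent datum. -/
def Desc.base (W : Desc F) (w : W.A.left) : D := onObj F (onObj W.A.hom w)

lemma Desc.base_act (W : Desc F) (w : W.A.left) (x : C) (h : Desc.base W w = onObj F x) :
    Desc.base W (Desc.act W w x h) = Desc.base W w :=
  (congrArg (onObj F) (Desc.hom_act W w x h)).trans h.symm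

lemma Desc.act_eq_self (W : Desc F) (w : W.A.left) (x : C) (h : Desc.base W w = onObj F x)
    (hx : x = onObj W.A.hom w) : Desc.act W w x h = w := by
  subst hx
  exact Desc.act_self W w

variable (s : D → C) (hs : ∀ y, onObj F (s y) = y)

/-- The representative of the orbit of `w` lying over the chosen section. -/
noncomputable def Desc.norm (W : Desc F) (w : W.A.left) : W.A.left :=
  Desc.act W w (s (Desc.base W w)) (hs _).symm

lemma Desc.base_norm (W : Desc F) (w : W.A.left) :
    Desc.base W (Desc.norm s hs W w) = Desc.base W w := Desc.base_act W _ _ _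

lemma Desc.act_norm (W : Desc F) (w : W.A.left) (x : C) (h : Desc.base W w = onObj F x) :
    Desc.act W (Desc.norm s hs W w) x ((Desc.base_norm s hs W w).trans h) = Desc.act W w x h :=
  Desc.act_act W w _ x (hs _).symm ((hs _).trans h)

lemma Desc.act_norm_hom (W : Desc F) (w : W.A.left) :
    Desc.act W (Desc.norm s hs W w) (onObj W.A.hom w) (Desc.base_norm s hs W w) = w :=
  (Desc.act_norm s hs W w _ rfl).trans (Desc.act_self W w)

lemma Desc.norm_act (W : Desc F) (w : W.A.left) (x : C) (h : Desc.base W w = onObj F x) :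
    Desc.norm s hs W (Desc.act W w x h) = Desc.norm s hs W w := by
  have e : s (Desc.base W (Desc.act W w x h)) = s (Desc.base W w) :=
    congrArg s (Desc.base_act W w x h)
  exact (Desc.act_congr W rfl e _).trans
    (Desc.act_act W w x _ h (h.symm.trans (hs _).symm))

lemma Desc.norm_eq_self (W : Desc F) (w : W.A.left)
    (hw : s (Desc.base W w) = onObj W.A.hom w) : Desc.norm s hs W w = w :=
  Desc.act_eq_self W w _ _ hw

/-- The objects of a descent datum lying over the chosen section; they represent the orbits. -/
abbrev Desc.Rep (W : Desc F) : Type u := {w : W.A.left // s (Desc.base W w) = onObj W.A.hom w}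

/-- The representative of the orbit of an object. -/
noncomputable def Desc.rep (W : Desc F) (w : W.A.left) : Desc.Rep s W :=
  ⟨Desc.norm s hs W w, by rw [Desc.base_norm]; exact (Desc.hom_act W _ _ _).symm⟩

variable [HasColimitsOfSize.{u, u} V]

/-- The hom of two orbits: the join of the homs between their elements. -/
noncomputable def Desc.orbitHom (W : Desc F) (a b : Desc.Rep s W) : V :=
  ∐ fun x : Fibre F (Desc.base W a.1) × Fibre F (Desc.base W b.1) =>
    ((Desc.act W a.1 x.1.1 x.1.2.symm ⟶[V] Desc.act W b.1 x.2.1 x.2.2.symm) : V)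

lemma Desc.nonempty_orbitHom (W : Desc F) (a b : Desc.Rep s W) (x x' : C)
    (h : Desc.base W a.1 = onObj F x) (h' : Desc.base W b.1 = onObj F x') {X : V}
    (k : Nonempty (X ⟶ (Desc.act W a.1 x h ⟶[V] Desc.act W b.1 x' h'))) :
    Nonempty (X ⟶ Desc.orbitHom s W a b) :=
  nonempty_trans k ⟨Sigma.ι (fun x : Fibre F (Desc.base W a.1) × Fibre F (Desc.base W b.1) =>
    ((Desc.act W a.1 x.1.1 x.1.2.symm ⟶[V] Desc.act W b.1 x.2.1 x.2.2.symm) : V))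
      (⟨x, h.symm⟩, ⟨x', h'.symm⟩)⟩

variable [MonoidalClosed V]

lemma Desc.nonempty_of_orbitHom (W : Desc F) (a b : Desc.Rep s W) {X Y : V}
    (h : Nonempty (X ⟶ Desc.orbitHom s W a b))
    (k : ∀ (x x' : C) (h : Desc.base W a.1 = onObj F x) (h' : Desc.base W b.1 = onObj F x')
      {Z : V}, Nonempty (Z ⟶ X) →
        Nonempty (Z ⟶ (Desc.act W a.1 x h ⟶[V] Desc.act W b.1 x' h')) → Nonempty (Z ⟶ Y)) :
    Nonempty (X ⟶ Y) :=
  nonempty_of_sigma h fun x => k _ _ x.1.2.symm x.2.2.symm ⟨fst _ _⟩ ⟨snd _ _⟩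

lemma Desc.nonempty_orbitHom_base (W : Desc F) (a b : Desc.Rep s W) {X : V}
    (h : Nonempty (X ⟶ Desc.orbitHom s W a b)) :
    Nonempty (X ⟶ (Desc.base W a.1 ⟶[V] Desc.base W b.1)) := by
  refine Desc.nonempty_of_orbitHom s W a b h fun x x' h h' Z _ hZ => ?_
  have := nonempty_trans hZ (nonempty_map (W.A.hom ≫ F) _ _)
  have e (c : W.A.left) (y : C) (hy : Desc.base W c = onObj F y) :
      onObj (W.A.hom ≫ F) (Desc.act W c y hy) = Desc.base W c := Desc.base_act W c y hy
  rwa [e, e] at this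

/-- Each joinand is a hom between some members of the orbits; functoriality of the action carries it
to x and x', and associativity erases the intermediate points. -/
lemma Desc.nonempty_orbitHom_act (W : Desc F) (a b : Desc.Rep s W) (x x' : C)
    (h : Desc.base W a.1 = onObj F x) (h' : Desc.base W b.1 = onObj F x') {X : V}
    (k : Nonempty (X ⟶ Desc.orbitHom s W a b)) (hx : Nonempty (X ⟶ (x ⟶[V] x'))) :
    Nonempty (X ⟶ (Desc.act W a.1 x h ⟶[V] Desc.act W b.1 x' h')) := by
  refine Desc.nonempty_of_orbitHom s W a b k fun t t' ht ht' Z hZ hZ' => ?_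
  have := Desc.nonempty_act W _ _ x x'
    ((Desc.base_act W a.1 t ht).trans h) ((Desc.base_act W b.1 t' ht').trans h') hZ'
    (nonempty_trans hZ hx)
  rwa [Desc.act_act W a.1 t x ht (ht.symm.trans h),
    Desc.act_act W b.1 t' x' ht' (ht'.symm.trans h')] at this

/-- Two joinands may end and start at different members of the middle orbit. Lifting their images in
`D` to x₀, x₁, x₂ moves both to the member over x₁, where they compose in `W`. -/
lemma Desc.nonempty_orbitHom_comp (hF : CoversPairs F) (W : Desc F) (a b c : Desc.Rep s W)
    {X : V} (h : Nonempty (X ⟶ Desc.orbitHom s W a b))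
    (h' : Nonempty (X ⟶ Desc.orbitHom s W b c)) : Nonempty (X ⟶ Desc.orbitHom s W a c) :=
  hF.nonempty_of_pair (Desc.nonempty_orbitHom_base s W a b h)
    (Desc.nonempty_orbitHom_base s W b c h') fun x₀ x₁ x₂ h₀ h₁ h₂ _ hZ hZ₀ hZ₁ =>
    Desc.nonempty_orbitHom s W a c x₀ x₂ h₀.symm h₂.symm
      (nonempty_comp
        (Desc.nonempty_orbitHom_act s W a b x₀ x₁ h₀.symm h₁.symm (nonempty_trans hZ h) hZ₀)
        (Desc.nonempty_orbitHom_act s W b c x₁ x₂ h₁.symm h₂.symm (nonempty_trans hZ h') hZ₁))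

/-- The `V`-category of orbits of a descent datum. -/
noncomputable def Desc.orbits (hF : CoversPairs F) (W : Desc F) : VCat.{w, v, u} V where
  carrier := Desc.Rep s W
  str :=
    { Hom := Desc.orbitHom s W
      id := fun a => (Desc.nonempty_orbitHom s W a a _ _ rfl rfl ⟨eId V _⟩).some
      comp := fun a b c => (Desc.nonempty_orbitHom_comp s hF W a b c ⟨fst _ _⟩ ⟨snd _ _⟩).some
      id_comp := fun _ _ => Subsingleton.elim _ _
      comp_id := fun _ _ => Subsingleton.elim _ _
      assoc := fun _ _ _ _ => Subsingleton.elim _ _ }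

/-- The `V`-category of orbits of a descent datum, over the codomain. -/
noncomputable def Desc.orbitsOver (hF : CoversPairs F) (W : Desc F) : Over D :=
  Over.mk (Y := Desc.orbits s hF W) (VCat.homMk (fun a : Desc.Rep s W => Desc.base W a.1)
    fun a b => Desc.nonempty_orbitHom_base s W a b ⟨𝟙 _⟩)

/-- The quotient map of a descent datum to its orbits. -/
noncomputable def Desc.toOrbits (hF : CoversPairs F) (W : Desc F) :
    W.A.left ⟶ (Desc.orbitsOver s hF W).left :=
  VCat.homMk (B := Desc.orbits s hF W) (Desc.rep s hs W) fun w w' => by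
    refine Desc.nonempty_orbitHom s W _ _ (onObj W.A.hom w) (onObj W.A.hom w')
      (Desc.base_norm s hs W w) (Desc.base_norm s hs W w') ?_
    exact ⟨eqToHom (congrArg₂ (fun a b : W.A.left => (a ⟶[V] b))
      (Desc.act_norm_hom s hs W w).symm (Desc.act_norm_hom s hs W w').symm)⟩

lemma Desc.toOrbits_comp (hF : CoversPairs F) (W : Desc F) :
    Desc.toOrbits s hs hF W ≫ (Desc.orbitsOver s hF W).hom = W.A.hom ≫ F :=
  hom_ext_of_thin fun w => Desc.base_norm s hs W w

/-- The comparison of a descent datum with the pullback of its orbits. -/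
noncomputable def Desc.toPullback (hF : CoversPairs F) (W : Desc F) :
    W.A.left ⟶ pullback (Desc.orbitsOver s hF W).hom F :=
  pullback.lift (Desc.toOrbits s hs hF W) W.A.hom (Desc.toOrbits_comp s hs hF W)

lemma Desc.onObj_toPullback (hF : CoversPairs F) (W : Desc F) (w : W.A.left) :
    onObj (Desc.toPullback s hs hF W) w =
      pullbackPt (F := (Desc.orbitsOver s hF W).hom) (G := F) (Desc.rep s hs W w)
        (onObj W.A.hom w) (Desc.base_norm s hs W w) :=
  onObj_lift _ _ _ w _

lemma Desc.isIso_toPullback (hF : CoversPairs F) (W : Desc F) :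
    IsIso (Desc.toPullback s hs hF W) := by
  have e := Desc.act_norm_hom s hs W
  have e₁ (w) : onObj (pullback.fst _ _) (onObj (Desc.toPullback s hs hF W) w) =
      Desc.rep s hs W w := 
    (congrArg (onObj _) (Desc.onObj_toPullback s hs hF W w)).trans (fst_pullbackPt _ _ _)
  have e₂ (w) : onObj (pullback.snd _ _) (onObj (Desc.toPullback s hs hF W) w) =
      onObj W.A.hom w := 
    (congrArg (onObj _) (Desc.onObj_toPullback s hs hF W w)).trans (snd_pullbackPt _ _ _)
  refine isIso_of_bijective _ ⟨fun w w' h => ?_, fun z => ?_⟩ fun w w' => ?_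
  · have h₁ : Desc.rep s hs W w = Desc.rep s hs W w' := by rw [← e₁, ← e₁, h]
    have h₂ : onObj W.A.hom w = onObj W.A.hom w' := by rw [← e₂, ← e₂, h]
    rw [← e w, ← e w']
    exact Desc.act_congr W (congrArg Subtype.val h₁) h₂ _
  · let a : Desc.Rep s W := onObj (pullback.fst _ _) z
    have hz : Desc.base W a.1 = onObj F (onObj (pullback.snd _ _) z) := pullback_w _ _ z
    refine ⟨Desc.act W a.1 _ hz, pullback_ext ?_ ?_⟩
    · rw [e₁]
      exact Subtype.ext ((Desc.norm_act s hs W _ _ _).trans (Desc.norm_eq_self s hs W a.1 a.2))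
    · rw [e₂]
      exact Desc.hom_act W _ _ _
  -- A hom in the pullback is an orbit hom together with a hom of `C`, exactly the data needed to
  -- act.
  · have h₁ := nonempty_map (pullback.fst (Desc.orbitsOver s hF W).hom F)
      (onObj (Desc.toPullback s hs hF W) w) (onObj (Desc.toPullback s hs hF W) w')
    have h₂ := nonempty_map (pullback.snd (Desc.orbitsOver s hF W).hom F)
      (onObj (Desc.toPullback s hs hF W) w) (onObj (Desc.toPullback s hs hF W) w')
    rw [e₁, e₁] at h₁
    rw [e₂, e₂] at h₂
    refine nonempty_trans (Desc.nonempty_orbitHom_act s W (Desc.rep s hs W w)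
      (Desc.rep s hs W w') _ _ (Desc.base_norm s hs W w) (Desc.base_norm s hs W w') h₁ h₂) ?_
    exact ⟨eqToHom (congrArg₂ (fun a b : W.A.left => (a ⟶[V] b)) (e w) (e w'))⟩

lemma descComparison_essSurj (hsurj : Function.Surjective (onObj F)) (hF : CoversPairs F) :
    (descComparison F).EssSurj where
  mem_essImage W := by
    choose s hs using hsurj
    let f : W.A ⟶ ((descComparison F).obj (Desc.orbitsOver s hF W)).A :=
      Over.homMk (Desc.toPullback s hs hF W) (pullback.lift_snd _ _ _)
    have : IsIso f.left := Desc.isIso_toPullback s hs hF W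
    have : IsIso f := (Over.isoMk (asIso f.left) (Over.w f)).isIso_hom
    let g : W ⟶ (descComparison F).obj (Desc.orbitsOver s hF W) := Desc.homMk f fun w x h => by
      have hn : Desc.rep s hs W (Desc.act W w x h) = Desc.rep s hs W w :=
        Subtype.ext (Desc.norm_act s hs W w x h)
      have h₀ : onObj (Desc.orbitsOver s hF W).hom (Desc.rep s hs W w) = onObj F x :=
        (Desc.base_norm s hs W w).trans h
      have h₁ : onObj f.left (Desc.act W w x h) =
          pullbackPt (F := (Desc.orbitsOver s hF W).hom) (G := F) (Desc.rep s hs W w) x h₀ :=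
        (Desc.onObj_toPullback s hs hF W _).trans
          (pullbackPt_congr hn (Desc.hom_act W w x h) _ h₀)
      refine h₁.trans (Eq.symm ?_)
      exact (Desc.act_congr _ (Desc.onObj_toPullback s hs hF W w) rfl _).trans
        (Desc.act_comparison _ _ _ x _ h₀ _)
    have : IsIso g.f := ‹IsIso f›
    have : IsIso g := Monad.algebra_iso_of_iso _ g
    exact ⟨_, ⟨(asIso g).symm⟩⟩

end EssSurj

end VCat

theorem mainTheorem2
    (V : Type v) [Category.{w} V] [Quiver.IsThin V] [CartesianMonoidalCategory V]
    [MonoidalClosed V] [HasColimitsOfSize.{u, u} V]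
    (C D : VCat.{w, v, u} V) (F : C ⟶ D)
    (hsurj : Function.Surjective (VCat.onObj F))
    (hjoin : ∀ y₀ y₁ y₂ : D, Nonempty
      ((∐ fun x : VCat.Fibre F y₀ × VCat.Fibre F y₁ × VCat.Fibre F y₂ =>
          ((x.2.1.1 ⟶[V] x.2.2.1) ⊗ (x.1.1 ⟶[V] x.2.1.1) : V)) ≅
        ((y₁ ⟶[V] y₂) ⊗ (y₀ ⟶[V] y₁) : V))) :
    IsEffectiveForDescent F := by
  have hF : VCat.CoversPairs F := fun y₀ y₁ y₂ => (hjoin y₀ y₁ y₂).map Iso.inv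
  have := VCat.pullback_faithful hsurj
  have := VCat.descComparison_full hsurj hF
  have := VCat.descComparison_essSurj hsurj hF
  -- Faithfulness of the comparison is inherited from that of the pullback functor.
  exact { }
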